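/- **Lemma (condition C2 on sets with polynomial decay).** Let $d,m,r\ge 0$ be integers and let $|\cdot|$ be a norm on $\mathbb Z^d$ (subadditive, even, zero only at $0$) with $|(k_1,\dots,k_d)|\ge |k_j|$ for all $j$. For unknowns $a=(a_k)_{k\in\mathbb Z^d}$, $a_k\in\mathbb C^m$ (treated as independent, no reality condition being imposed), consider the ladder of equations $$\frac{da_k}{dt}=F_k(a):=-\lambda_k a_k+N_k(a),\qquad k\in\mathbb Z^d,$$ where $N=N(u,Du,\dots,D^ru)$ is a $\mathbb C^m$-valued polynomial with complex coefficients in the partial derivatives of order at most $r$ of $u=(u_1,\dots,u_m)$, and $N_k(a)$ is the $k$-th Fourier coefficient of $N(u,Du,\dots,D^ru)$ for $u(x)=\sum_k a_ke^{ik\cdot x}$, i.e. the linear combination, over the monomials of $N$, of the convolution sums $\sum_{k_1+\dots+k_l=k}v^{(1)}_{k_1}\cdots v^{(l)}_{k_l}$, with $v_k=i^{|\alpha|}k^\alpha a_{k,j}$ for a factor $v=D^\alpha u_j$. Assume that $\lambda_k\in\mathbb R$ and that there are real constants $p>r$, $K$, $L_*>0$, $L^*$ with $$L_*|k|^p\le\lambda_k\le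 L^*|k|^p\qquad\text{for all }|k|>K .$$ Write the system in the real coordinates indexed by $I=\mathbb Z^d\times\{1,\dots,m\}\times\{0,1\}$ (real and imaginary parts of the components of the $a_k$). Let $H$ be one of the real sequence spaces $c_0(I)$, $l_1(I)$, $l_2(I)$ with its usual norm, let $J_0\subset J_1\subset\cdots$ be non-empty finite subsets of $I$ with $\bigcup_n J_n=I$ (a Galerkin filtration), let $P_n$ be the projection onto the coordinates in $J_n$, and let $F^n=P_n\circ F|_{P_nH}:P_nH\to P_nH$. Let $C\in\mathbb R$, let $$s>2r+d,\qquad W=W_P(C,s)=\Big\{a:\ |a_k|\le \frac{C}{|k|^s}\ (k\ne0),\ |a_0|\le C\Big\},$$ where $|a_k|$ is the Euclidean norm on $\mathbb C^m$. Then $F$ satisfies condition **C2** on $W$: one has $W\subset H$, every $F^n$ is of class $C^1$, and there is $l\in\mathbb R$ such that $$\mu\big(DF^n(P_nz)\big)\le l\qquad\text{for all } n\ge 0\text{ and all } z\in W,$$ where $\mu(A)=\lim_{h\to0^+}\frac{\|I+hA\|-1}{h}$ (the limit exists) is the logarithmic norm of a linear map $A:P_nH\to P_nH$ with respect to the norm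 of $H$; that is, $\mu=\mu_\infty,\mu_1,\mu_2$ for $H=c_0,l_1,l_2$ respectively. -/

import Mathlib

open Filter Topology
open scoped ENNReal

noncomputable section

namespace TorusPDE

/-- Index set of the real unknowns: `(k, j, false)` is the real part and `(k, j, true)` the imaginary
part of the `j`-th component of the Fourier coefficient with wave vector `k ∈ ℤ^d`. -/
abbrev Mode (d m : ℕ) : Type := (Fin d → ℤ) × Fin m × Bool

/-- The `j`-th component of the Fourier coefficient `a_k ∈ ℂ^m`. -/
def coef {d m : ℕ} (a : Mode d m → ℝ) (k : Fin d → ℤ) (j : Fin m) : ℂ :=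
  ⟨a (k, j, false), a (k, j, true)⟩

/-- The arguments of the nonlinearity: the pair `(α, j)` stands for the partial derivative
`D^α u_j`, where `α` is a multi-index with `|α| ≤ r`. -/
abbrev JetVar (d m r : ℕ) : Type := {α : Fin d → Fin (r + 1) // ∑ i, (α i : ℕ) ≤ r} × Fin m

/-- The `k`-th Fourier coefficient `i^{|α|} k^α a_{k,j}` of `D^α u_j`. -/
def jetCoef {d m r : ℕ} (a : Mode d m → ℝ) (v : JetVar d m r) (k : Fin d → ℤ) : ℂ :=
  (∏ i, (Complex.I * (k i : ℂ)) ^ (v.1.1 i : ℕ)) * coef a k v.2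

/-- The `k`-th Fourier coefficient of the monomial `∏ v, v ^ σ v` in the derivatives of `u`:
the sum over all `k_1 + ⋯ + k_l = k` (one wave vector for each of the `l` factors)
of the products of the coefficients of the factors. -/
def monomialCoef {d m r : ℕ} (σ : JetVar d m r →₀ ℕ) (a : Mode d m → ℝ) (k : Fin d → ℤ) : ℂ :=
  ∑' κ : {κ : (Σ v : JetVar d m r, Fin (σ v)) → (Fin d → ℤ) // ∑ i, κ i = k},
    ∏ i, jetCoef a i.1 (κ.1 i)

/-- The `k`-th Fourier coefficient `P_k(a)` of `P(u, Du, …, D^r u)`, `P` a polynomial. -/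
def polyCoef {d m r : ℕ} (P : MvPolynomial (JetVar d m r) ℂ) (a : Mode d m → ℝ)
    (k : Fin d → ℤ) : ℂ :=
  ∑ σ ∈ P.support, P.coeff σ * monomialCoef σ a k

/-- The vector field `F_k(a) = -λ_k a_k + N_k(a)`, written in real coordinates. -/
def vectorField {d m r : ℕ} (lam : (Fin d → ℤ) → ℝ)
    (N : Fin m → MvPolynomial (JetVar d m r) ℂ) (a : Mode d m → ℝ) : Mode d m → ℝ
  | (k, j, false) => (-(lam k : ℂ) * coef a k j + polyCoef (N j) a k).re
  | (k, j, true) => (-(lam k : ℂ) * coef a k j + polyCoef (N j) a k).im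

/-- The set with polynomial decay `W_P(C, s)`: `|a_k| ≤ C / |k|^s` for `k ≠ 0` and `|a_0| ≤ C`,
with the Euclidean norm of `a_k ∈ ℂ^m`. -/
def polyDecaySet {d m : ℕ} (ν : AddGroupNorm (Fin d → ℤ)) (C s : ℝ) : Set (Mode d m → ℝ) :=
  {a | (∀ k, k ≠ 0 → ‖WithLp.toLp 2 (coef a k)‖ ≤ C / ν k ^ s) ∧
    ‖WithLp.toLp 2 (coef a 0)‖ ≤ C}

/-- The three sequence spaces under consideration. -/
inductive SeqSpace where
  | c0 : SeqSpace
  | l1 : SeqSpace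
  | l2 : SeqSpace

/-- The real sequences belonging to the space. -/
def SeqSpace.carrier {ι : Type} : SeqSpace → Set (ι → ℝ)
  | .c0 => {a | Tendsto a cofinite (𝓝 0)}
  | .l1 => {a | Memℓp a 1}
  | .l2 => {a | Memℓp a 2}

/-- The norm of `c0`, `l1`, `l2` is the `ℓ^q` norm with `q = ∞, 1, 2`. -/
def SeqSpace.exponent : SeqSpace → ℝ≥0∞
  | .c0 => ∞
  | .l1 => 1
  | .l2 => 2

instance SeqSpace.fact_one_le (H : SeqSpace) : Fact (1 ≤ H.exponent) :=
  ⟨by cases H <;> simp [SeqSpace.exponent]⟩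

/-- A Galerkin filtration: an increasing sequence of finite sets of indices exhausting
the whole index set. -/
structure GalerkinFiltration (ι : Type) where
  sets : ℕ → Finset ι
  nonempty : ∀ n, (sets n).Nonempty
  mono : Monotone sets
  exhaust : ∀ i, ∃ n, i ∈ sets n

/-- The finite dimensional space `P_n H`, with the norm inherited from `H`. -/
abbrev GalerkinSpace {ι : Type} (H : SeqSpace) (S : Finset ι) : Type :=
  PiLp H.exponent (fun _ : S => ℝ)

/-- The projection `P_n`, which keeps the coordinates in `S`. -/
def proj {ι : Type} (H : SeqSpace) (S : Finset ι) (z : ι → ℝ) : GalerkinSpace H S :=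
  WithLp.toLp _ (fun i : S => z i)

open Classical in
/-- The inclusion of `P_n H` into the space of sequences (extension by zero). -/
def embed {ι : Type} (H : SeqSpace) (S : Finset ι) (y : GalerkinSpace H S) : ι → ℝ :=
  fun i => if h : i ∈ S then y ⟨i, h⟩ else 0

/-- The Galerkin projection `F^n = P_n ∘ F` restricted to `P_n H`. -/
def galerkin {ι : Type} (H : SeqSpace) (S : Finset ι) (F : (ι → ℝ) → (ι → ℝ)) :
    GalerkinSpace H S → GalerkinSpace H S :=
  fun y => proj H S (F (embed H S y))

/-- `μ` is the logarithmic norm of `A`: `μ = lim_{h → 0+} (‖I + h A‖ - 1) / h`. -/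
def IsLogNorm {E : Type} [NormedAddCommGroup E] [NormedSpace ℝ E] (A : E →L[ℝ] E) (μ : ℝ) :
    Prop :=
  Tendsto (fun h : ℝ => (‖ContinuousLinearMap.id ℝ E + h • A‖ - 1) / h) (𝓝[>] 0) (𝓝 μ)

/-- Condition C2 for `F` on `W ⊆ H`: all Galerkin projections `F^n` are of class `C^1`, and there
is a common upper bound for the logarithmic norms (with respect to the norm of `H`) of the
Jacobians `DF^n(P_n z)`, over all `n` and all `z ∈ W`. -/
def ConditionC2 {ι : Type} (H : SeqSpace) (J : GalerkinFiltration ι) (F : (ι → ℝ) → (ι → ℝ))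
    (W : Set (ι → ℝ)) : Prop :=
  W ⊆ H.carrier ∧
  (∀ n, ContDiff ℝ 1 (galerkin H (J.sets n) F)) ∧
  ∃ l : ℝ, ∀ n, ∀ z ∈ W, ∃ μ : ℝ,
    IsLogNorm (fderiv ℝ (galerkin H (J.sets n) F) (proj H (J.sets n) z)) μ ∧ μ ≤ l

end TorusPDE

end

/-!
On `P_n H` the function `u` is a trigonometric polynomial, so its derivatives lie in the convolution
algebra of `ℤ^d` and `N_k(a)` is a coefficient of the polynomial `N` evaluated in that algebra. By
the chain rule, the entries of the Jacobian of the nonlinear part are at most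
`β(k - q) (1 + |q|)^r`, where `β` sums the absolute values of the Fourier coefficients of
`∂N/∂(D^α u_j)`. The `ℓ¹` norm with weight `(1 + |k|)^r` is submultiplicative and, since
`s > 2r + d`, it is bounded on the derivatives of the elements of `W`, hence on `β`. Moving the
weight between `q` and `k` therefore bounds the row and column sums through `k` by
`c (1 + |k|)^r`, uniformly in `n`. As `p > r`, the diagonal part `-λ_k` dominates this for all but
finitely many `k`, and Schur's test turns a common bound on row and column sums into a bound on the
logarithmic norm in every `ℓ^q`.
-/

namespace TorusPDE

open scoped AddMonoidAlgebra Matrix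

section LogarithmicNorm

variable {E : Type} [NormedAddCommGroup E] [NormedSpace ℝ E]

theorem convexOn_norm_id_add_smul (A : E →L[ℝ] E) :
    ConvexOn ℝ Set.univ fun h : ℝ => ‖ContinuousLinearMap.id ℝ E + h • A‖ := by
  have hconv := (convexOn_univ_norm (E := E →L[ℝ] E)).comp_affineMap
    (AffineMap.lineMap (ContinuousLinearMap.id ℝ E) (ContinuousLinearMap.id ℝ E + A) : ℝ →ᵃ[ℝ] _)
  simpa [Function.comp_def, AffineMap.lineMap_apply, add_comm] using hconv

theorem exists_isLogNorm [Nontrivial E] (A : E →L[ℝ] E) : ∃ μ, IsLogNorm A μ := by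
  have hderiv := (convexOn_norm_id_add_smul A).hasDerivWithinAt_sInf_slope_of_mem_interior
    (x := 0) (by simp)
  rw [hasDerivWithinAt_iff_tendsto_slope' Set.self_notMem_Ioi] at hderiv
  exact ⟨_, by simpa [IsLogNorm, slope_fun_def_field] using hderiv⟩

theorem IsLogNorm.le_of_eventually_norm_le {A : E →L[ℝ] E} {μ l : ℝ} (hμ : IsLogNorm A μ)
    (hl : ∀ᶠ h in 𝓝[>] (0 : ℝ), ‖ContinuousLinearMap.id ℝ E + h • A‖ ≤ 1 + h * l) : μ ≤ l := by
  refine le_of_tendsto hμ ?_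
  filter_upwards [hl, self_mem_nhdsWithin] with h hnorm (hpos : 0 < h)
  rw [div_le_iff₀ hpos]
  linarith

end LogarithmicNorm

section SchurTest

theorem rpow_sum_mul_le_of_nonneg {ι : Type*} (s : Finset ι) {q : ℝ} (hq : 1 ≤ q) {w f : ι → ℝ}
    (hw : ∀ i, 0 ≤ w i) (hf : ∀ i, 0 ≤ f i) :
    (∑ i ∈ s, w i * f i) ^ q ≤ (∑ i ∈ s, w i) ^ (q - 1) * ∑ i ∈ s, w i * f i ^ q := by
  have hq0 : q ≠ 0 := by positivity
  have hw_sum : 0 ≤ ∑ i ∈ s, w i := Finset.sum_nonneg fun i _ => hw i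
  have hwf_sum : 0 ≤ ∑ i ∈ s, w i * f i ^ q :=
    Finset.sum_nonneg fun i _ => mul_nonneg (hw i) (Real.rpow_nonneg (hf i) q)
  calc (∑ i ∈ s, w i * f i) ^ q
      ≤ ((∑ i ∈ s, w i) ^ (1 - q⁻¹) * (∑ i ∈ s, w i * f i ^ q) ^ q⁻¹) ^ q :=
        Real.rpow_le_rpow (Finset.sum_nonneg fun i _ => mul_nonneg (hw i) (hf i))
          (Real.inner_le_weight_mul_Lp_of_nonneg s hq w f hw hf) (by positivity)
    _ = (∑ i ∈ s, w i) ^ (q - 1) * ∑ i ∈ s, w i * f i ^ q := by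
        rw [Real.mul_rpow (by positivity) (by positivity), ← Real.rpow_mul hw_sum,
          Real.rpow_inv_rpow hwf_sum hq0, sub_mul, one_mul, inv_mul_cancel₀ hq0]

theorem norm_mulVec_apply_le {ι κ 𝕜 : Type*} [Fintype κ] [NonUnitalSeminormedRing 𝕜]
    (A : Matrix ι κ 𝕜) (x : κ → 𝕜) (i : ι) :
    ‖(A.mulVec x) i‖ ≤ ∑ j, ‖A i j‖ * ‖x j‖ :=
  norm_sum_le_of_le _ fun _ _ => norm_mul_le _ _

theorem norm_toLp_rpow_eq_sum {ι E : Type*} [Fintype ι] [SeminormedAddCommGroup E] {p : ℝ≥0∞}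
    (hp : 0 < p.toReal) (y : ι → E) :
    ‖WithLp.toLp p y‖ ^ p.toReal = ∑ i, ‖y i‖ ^ p.toReal := by
  rw [PiLp.norm_eq_sum hp, one_div, Real.rpow_inv_rpow (by positivity) hp.ne']

theorem norm_toLp_top_mulVec_le {ι κ 𝕜 : Type*} [Fintype ι] [Fintype κ]
    [NonUnitalSeminormedRing 𝕜] (A : Matrix ι κ 𝕜) {R : ℝ} (hR : 0 ≤ R)
    (hrow : ∀ i, ∑ j, ‖A i j‖ ≤ R) (x : κ → 𝕜) :
    ‖WithLp.toLp ∞ (A.mulVec x)‖ ≤ R * ‖WithLp.toLp ∞ x‖ := by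
  rw [PiLp.norm_eq_ciSup]
  refine Real.iSup_le (fun i => ?_) (by positivity)
  calc ‖A.mulVec x i‖ ≤ ∑ j, ‖A i j‖ * ‖x j‖ := norm_mulVec_apply_le A x i
    _ ≤ ∑ j, ‖A i j‖ * ‖WithLp.toLp ∞ x‖ := by
        gcongr with j
        exact PiLp.norm_apply_le (WithLp.toLp ∞ x) j
    _ ≤ R * ‖WithLp.toLp ∞ x‖ := by
        rw [← Finset.sum_mul]
        gcongr
        exact hrow i

/- For finite `p` this is interpolation by Hölder's inequality: the row sums are raised to the power
`p - 1` and the column sums to the power `1`. -/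
theorem norm_toLp_mulVec_le_of_sum_norm_le {ι κ 𝕜 : Type*} [Fintype ι] [Fintype κ]
    [NonUnitalSeminormedRing 𝕜] (p : ℝ≥0∞) [Fact (1 ≤ p)] (A : Matrix ι κ 𝕜) {R : ℝ}
    (hrow : ∀ i, ∑ j, ‖A i j‖ ≤ R) (hcol : ∀ j, ∑ i, ‖A i j‖ ≤ R) (x : κ → 𝕜) :
    ‖WithLp.toLp p (A.mulVec x)‖ ≤ R * ‖WithLp.toLp p x‖ := by
  obtain hκ | ⟨⟨j₀⟩⟩ := isEmpty_or_nonempty κ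
  · simp [Subsingleton.elim x 0]
  have hR : 0 ≤ R := (Finset.sum_nonneg fun _ _ => norm_nonneg _).trans (hcol j₀)
  obtain rfl | hp := eq_or_ne p ∞
  · exact norm_toLp_top_mulVec_le A hR hrow x
  · have hq : 1 ≤ p.toReal := by simpa using ENNReal.toReal_mono hp (Fact.out : 1 ≤ p)
    have hq0 : 0 < p.toReal := by positivity
    rw [← Real.rpow_le_rpow_iff (by positivity) (by positivity) hq0,
      Real.mul_rpow hR (by positivity), norm_toLp_rpow_eq_sum hq0, norm_toLp_rpow_eq_sum hq0]
    calc ∑ i, ‖A.mulVec x i‖ ^ p.toReal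
        ≤ ∑ i, R ^ (p.toReal - 1) * ∑ j, ‖A i j‖ * ‖x j‖ ^ p.toReal := by
          gcongr with i
          refine (Real.rpow_le_rpow (by positivity) (norm_mulVec_apply_le A x i) hq0.le).trans
            ((rpow_sum_mul_le_of_nonneg _ hq (by simp) (by simp)).trans ?_)
          gcongr
          exact hrow i
      _ = R ^ (p.toReal - 1) * ∑ j, (∑ i, ‖A i j‖) * ‖x j‖ ^ p.toReal := by
          rw [← Finset.mul_sum, Finset.sum_comm]
          simp only [Finset.sum_mul]
      _ ≤ R ^ (p.toReal - 1) * ∑ j, R * ‖x j‖ ^ p.toReal := by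
          gcongr with j
          exact hcol j
      _ = R ^ p.toReal * ∑ j, ‖x j‖ ^ p.toReal := by
          rw [← Finset.mul_sum, ← mul_assoc, ← Real.rpow_add_one' hR (by simpa using hq0.ne'),
            sub_add_cancel]

theorem sum_abs_diagonal_add_smul_row_le {ι : Type*} [Fintype ι] [DecidableEq ι] {c : ι → ℝ} {h : ℝ}
    (hh : 0 ≤ h) (B : Matrix ι ι ℝ) {i : ι} (hc : 0 ≤ 1 + h * c i) :
    ∑ j, |(Matrix.diagonal (fun i => 1 + h * c i) + h • B) i j| ≤
      1 + h * (c i + ∑ j, |B i j|) := by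
  calc ∑ j, |(Matrix.diagonal (fun i => 1 + h * c i) + h • B) i j|
      ≤ ∑ j, ((if i = j then 1 + h * c i else 0) + h * |B i j|) := by
        gcongr with j
        refine (abs_add_le _ _).trans_eq ?_
        rw [Matrix.diagonal_apply, Matrix.smul_apply, smul_eq_mul, abs_mul, abs_of_nonneg hh,
          apply_ite abs, abs_of_nonneg hc, abs_zero]
    _ = 1 + h * (c i + ∑ j, |B i j|) := by
        rw [Finset.sum_add_distrib, Finset.sum_ite_eq, if_pos (Finset.mem_univ i),
          ← Finset.mul_sum]
        ring

theorem norm_id_add_smul_le_of_row_col {ι : Type*} [Fintype ι] [Nonempty ι] {p : ℝ≥0∞}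
    [Fact (1 ≤ p)] (A : PiLp p (fun _ : ι => ℝ) →L[ℝ] PiLp p (fun _ : ι => ℝ)) {c : ι → ℝ}
    {B : Matrix ι ι ℝ} (hA : ∀ x i, A x i = c i * x i + B.mulVec x i) {l : ℝ}
    (hrow : ∀ i, c i + ∑ j, |B i j| ≤ l) (hcol : ∀ j, c j + ∑ i, |B i j| ≤ l) {h : ℝ} (hh : 0 ≤ h)
    (hc : ∀ i, 0 ≤ 1 + h * c i) :
    ‖ContinuousLinearMap.id ℝ (PiLp p fun _ : ι => ℝ) + h • A‖ ≤ 1 + h * l := by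
  classical
  set M : Matrix ι ι ℝ := Matrix.diagonal (fun i => 1 + h * c i) + h • B with hM
  have hMrow : ∀ i, ∑ j, |M i j| ≤ 1 + h * l := fun i =>
    (sum_abs_diagonal_add_smul_row_le hh B (hc i)).trans (by gcongr; exact hrow i)
  have hMcol : ∀ j, ∑ i, |M i j| ≤ 1 + h * l := fun j => by
    have htranspose : Mᵀ = Matrix.diagonal (fun i => 1 + h * c i) + h • Bᵀ := by simp [hM]
    change ∑ i, |Mᵀ j i| ≤ _
    rw [htranspose]
    exact (sum_abs_diagonal_add_smul_row_le hh Bᵀ (hc j)).trans (by gcongr; exact hcol j)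
  obtain ⟨i₀⟩ := ‹Nonempty ι›
  refine ContinuousLinearMap.opNorm_le_bound _
    ((Finset.sum_nonneg fun _ _ => abs_nonneg _).trans (hMrow i₀)) fun x => ?_
  have happly : (ContinuousLinearMap.id ℝ (PiLp p fun _ : ι => ℝ) + h • A) x =
      WithLp.toLp p (M.mulVec x.ofLp) := by
    ext i
    simp only [add_apply, ContinuousLinearMap.id_apply, smul_apply, PiLp.add_apply,
      PiLp.smul_apply, hA, smul_eq_mul, hM, Matrix.add_mulVec, Matrix.smul_mulVec, Pi.add_apply,
      Matrix.mulVec_diagonal, Pi.smul_apply]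
    ring
  rw [happly]
  exact norm_toLp_mulVec_le_of_sum_norm_le p M hMrow hMcol x.ofLp

theorem exists_isLogNorm_le_of_row_col {ι : Type} [Fintype ι] [Nonempty ι] {p : ℝ≥0∞}
    [Fact (1 ≤ p)] (A : PiLp p (fun _ : ι => ℝ) →L[ℝ] PiLp p (fun _ : ι => ℝ)) {c : ι → ℝ}
    {B : Matrix ι ι ℝ} (hA : ∀ x i, A x i = c i * x i + B.mulVec x i) {l : ℝ}
    (hrow : ∀ i, c i + ∑ j, |B i j| ≤ l) (hcol : ∀ j, c j + ∑ i, |B i j| ≤ l) :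
    ∃ μ, IsLogNorm A μ ∧ μ ≤ l := by
  obtain ⟨μ, hμ⟩ := exists_isLogNorm A
  refine ⟨μ, hμ, hμ.le_of_eventually_norm_le ?_⟩
  have hsmall : ∀ᶠ h in 𝓝[>] (0 : ℝ), ∀ i, 0 ≤ 1 + h * c i := by
    refine eventually_all.2 fun i => nhdsWithin_le_nhds ?_
    have hlim : Tendsto (fun h : ℝ => 1 + h * c i) (𝓝 0) (𝓝 1) :=
      Continuous.tendsto' (by fun_prop) _ _ (by simp)
    exact hlim.eventually_const_le one_pos
  filter_upwards [hsmall, self_mem_nhdsWithin] with h hc (hpos : 0 < h)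
  exact norm_id_add_smul_le_of_row_col A hA hrow hcol hpos.le hc

end SchurTest

section WeightedConvolution

/-- A symmetric Beurling weight on an additive group: the associated weighted `ℓ¹` norm is
submultiplicative for convolution and dominates the `ℓ¹` norm. -/
structure IsBeurlingWeight {G : Type*} [AddGroup G] (ω : G → ℝ) : Prop where
  one_le : ∀ k, 1 ≤ ω k
  neg : ∀ k, ω (-k) = ω k
  add_le_mul : ∀ k q, ω (k + q) ≤ ω k * ω q

theorem IsBeurlingWeight.nonneg {G : Type*} [AddGroup G] {ω : G → ℝ} (hω : IsBeurlingWeight ω)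
    (k : G) : 0 ≤ ω k :=
  zero_le_one.trans (hω.one_le k)

theorem IsBeurlingWeight.le_mul_sub {G : Type*} [AddCommGroup G] {ω : G → ℝ}
    (hω : IsBeurlingWeight ω) (k q : G) : ω q ≤ ω k * ω (k - q) := by
  have hneg : ω (q - k) = ω (k - q) := by rw [← hω.neg, neg_sub]
  calc ω q = ω (k + (q - k)) := by rw [add_sub_cancel]
    _ ≤ ω k * ω (k - q) := hneg ▸ hω.add_le_mul k (q - k)

theorem isBeurlingWeight_one_add_seminorm_pow {F G : Type*} [AddGroup G] [FunLike F G ℝ]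
    [AddGroupSeminormClass F G ℝ] (ν : F) (r : ℕ) :
    IsBeurlingWeight fun k : G => (1 + ν k) ^ r where
  one_le k := one_le_pow₀ (by linarith [apply_nonneg ν k])
  neg k := by rw [map_neg_eq_map]
  add_le_mul k q := by
    have hk := apply_nonneg ν k
    have hq := apply_nonneg ν q
    rw [← mul_pow]
    gcongr
    nlinarith [map_add_le_add ν k q]

/-- The weighted `ℓ¹` norm `∑ ω(k) |f_k|` of a finitely supported family, viewed as an element of
the convolution algebra of the group, i.e. as a trigonometric polynomial. -/
def weightedL1Norm {R G : Type*} [SeminormedRing R] (ω : G → ℝ) (f : R[G]) : ℝ :=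
  f.coeff.sum fun k c => ω k * ‖c‖

variable {R G τ : Type*}

theorem weightedL1Norm_eq_sum [SeminormedRing R] (ω : G → ℝ) {f : R[G]} {s : Finset G}
    (hs : f.coeff.support ⊆ s) : weightedL1Norm ω f = ∑ k ∈ s, ω k * ‖f.coeff k‖ :=
  Finsupp.sum_of_support_subset _ hs _ (by simp)

theorem sum_le_weightedL1Norm [SeminormedRing R] {ω : G → ℝ} (hω : ∀ k, 0 ≤ ω k) (f : R[G])
    (s : Finset G) : ∑ k ∈ s, ω k * ‖f.coeff k‖ ≤ weightedL1Norm ω f := by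
  classical
  rw [weightedL1Norm_eq_sum ω (Finset.subset_union_right (s₁ := s))]
  exact Finset.sum_le_sum_of_subset_of_nonneg Finset.subset_union_left
    fun k _ _ => mul_nonneg (hω k) (norm_nonneg _)

theorem weightedL1Norm_nonneg [SeminormedRing R] {ω : G → ℝ} (hω : ∀ k, 0 ≤ ω k) (f : R[G]) :
    0 ≤ weightedL1Norm ω f := by
  simpa using sum_le_weightedL1Norm hω f ∅

theorem weightedL1Norm_single [SeminormedRing R] (ω : G → ℝ) (k : G) (c : R) :
    weightedL1Norm ω (AddMonoidAlgebra.single k c) = ω k * ‖c‖ := by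
  rw [weightedL1Norm, AddMonoidAlgebra.coeff_single, Finsupp.sum_single_index (by simp)]

theorem weightedL1Norm_add_le [SeminormedRing R] {ω : G → ℝ} (hω : ∀ k, 0 ≤ ω k) (f g : R[G]) :
    weightedL1Norm ω (f + g) ≤ weightedL1Norm ω f + weightedL1Norm ω g := by
  classical
  have hsupport : (f + g).coeff.support ⊆ f.coeff.support ∪ g.coeff.support := by
    rw [AddMonoidAlgebra.coeff_add]
    exact Finsupp.support_add
  rw [weightedL1Norm_eq_sum ω hsupport, weightedL1Norm_eq_sum ω Finset.subset_union_left,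
    weightedL1Norm_eq_sum ω (Finset.subset_union_right (s₁ := f.coeff.support)),
    ← Finset.sum_add_distrib]
  gcongr with k
  rw [AddMonoidAlgebra.coeff_add, Finsupp.add_apply, ← mul_add]
  exact mul_le_mul_of_nonneg_left (norm_add_le _ _) (hω k)

theorem weightedL1Norm_sum_le [SeminormedRing R] {ω : G → ℝ} (hω : ∀ k, 0 ≤ ω k)
    (s : Finset τ) (f : τ → R[G]) :
    weightedL1Norm ω (∑ i ∈ s, f i) ≤ ∑ i ∈ s, weightedL1Norm ω (f i) :=
  Finset.le_sum_of_subadditive _ (by simp [weightedL1Norm]) (weightedL1Norm_add_le hω) s f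

theorem weightedL1Norm_mul_le [SeminormedRing R] [AddGroup G] {ω : G → ℝ}
    (hω : IsBeurlingWeight ω) (f g : R[G]) :
    weightedL1Norm ω (f * g) ≤ weightedL1Norm ω f * weightedL1Norm ω g := by
  rw [AddMonoidAlgebra.mul_def, Finsupp.sum]
  refine (weightedL1Norm_sum_le hω.nonneg _ _).trans ?_
  rw [weightedL1Norm, weightedL1Norm, Finsupp.sum, Finset.sum_mul]
  gcongr with k
  rw [Finsupp.sum, Finsupp.sum, Finset.mul_sum]
  refine (weightedL1Norm_sum_le hω.nonneg _ _).trans ?_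
  gcongr with q
  rw [weightedL1Norm_single, mul_mul_mul_comm]
  exact mul_le_mul (hω.add_le_mul k q) (norm_mul_le _ _) (norm_nonneg _)
    (mul_nonneg (hω.nonneg k) (hω.nonneg q))

theorem exists_weightedL1Norm_aeval_le [SeminormedCommRing R] [AddCommGroup G] {ω : G → ℝ}
    (hω : IsBeurlingWeight ω) (M : ℝ) (P : MvPolynomial τ R) :
    ∃ B, ∀ A : τ → R[G], (∀ v, weightedL1Norm ω (A v) ≤ M) →
      weightedL1Norm ω (MvPolynomial.aeval A P) ≤ B := by
  induction P using MvPolynomial.induction_on with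
  | C c =>
    refine ⟨ω 0 * ‖c‖, fun A _ => ?_⟩
    rw [MvPolynomial.aeval_C, AddMonoidAlgebra.coe_algebraMap, Function.comp_apply,
      Algebra.algebraMap_self_apply, weightedL1Norm_single]
  | add P Q hP hQ =>
    obtain ⟨B, hB⟩ := hP
    obtain ⟨B', hB'⟩ := hQ
    refine ⟨B + B', fun A hA => ?_⟩
    rw [map_add]
    exact (weightedL1Norm_add_le hω.nonneg _ _).trans (add_le_add (hB A hA) (hB' A hA))
  | mul_X P v hP =>
    obtain ⟨B, hB⟩ := hP
    refine ⟨B * M, fun A hA => ?_⟩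
    rw [map_mul, MvPolynomial.aeval_X]
    exact (weightedL1Norm_mul_le hω _ _).trans (mul_le_mul (hB A hA) (hA v)
      (weightedL1Norm_nonneg hω.nonneg _) ((weightedL1Norm_nonneg hω.nonneg _).trans (hB A hA)))

theorem IsBeurlingWeight.sum_sub_mul_row_le [AddCommGroup G] {ω β : G → ℝ}
    (hω : IsBeurlingWeight ω) (hβ : ∀ k, 0 ≤ β k) {B : ℝ}
    (hB : ∀ s : Finset G, ∑ k ∈ s, ω k * β k ≤ B) (s : Finset G) (k : G) :
    ∑ q ∈ s, β (k - q) * ω q ≤ B * ω k :=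
  calc ∑ q ∈ s, β (k - q) * ω q
      ≤ ∑ q ∈ s, ω (k - q) * β (k - q) * ω k := by
        refine Finset.sum_le_sum fun q _ => ?_
        rw [mul_comm (ω (k - q)), mul_assoc, mul_comm (ω (k - q))]
        exact mul_le_mul_of_nonneg_left (hω.le_mul_sub k q) (hβ _)
    _ = (∑ q ∈ s.map (Equiv.subLeft k).toEmbedding, ω q * β q) * ω k := by
        rw [Finset.sum_map, Finset.sum_mul]
        rfl
    _ ≤ B * ω k := mul_le_mul_of_nonneg_right (hB _) (hω.nonneg k)

theorem IsBeurlingWeight.sum_sub_mul_col_le [AddCommGroup G] {ω β : G → ℝ}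
    (hω : IsBeurlingWeight ω) (hβ : ∀ k, 0 ≤ β k) {B : ℝ}
    (hB : ∀ s : Finset G, ∑ k ∈ s, ω k * β k ≤ B) (s : Finset G) (q : G) :
    ∑ k ∈ s, β (k - q) * ω q ≤ B * ω q :=
  calc ∑ k ∈ s, β (k - q) * ω q
      ≤ ∑ k ∈ s, ω (k - q) * β (k - q) * ω q := by
        gcongr with k
        · exact hω.nonneg q
        · exact le_mul_of_one_le_left (hβ _) (hω.one_le _)
    _ = (∑ k ∈ s.map (Equiv.subRight q).toEmbedding, ω k * β k) * ω q := by
        rw [Finset.sum_map, Finset.sum_mul]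
        rfl
    _ ≤ B * ω q := mul_le_mul_of_nonneg_right (hB _) (hω.nonneg q)

theorem sum_comp_fst_le {α β : Type*} [DecidableEq α] [Fintype β] {f : α → ℝ} (hf : ∀ a, 0 ≤ f a)
    (S : Finset (α × β)) :
    ∑ i ∈ S, f i.1 ≤ Fintype.card β * ∑ a ∈ S.image Prod.fst, f a :=
  calc ∑ i ∈ S, f i.1 ≤ ∑ i ∈ S.image Prod.fst ×ˢ Finset.univ, f i.1 :=
        Finset.sum_le_sum_of_subset_of_nonneg
          (fun i hi => by simpa using ⟨i.2, hi⟩) fun i _ _ => hf i.1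
    _ = Fintype.card β * ∑ a ∈ S.image Prod.fst, f a := by
        simp only [Finset.sum_product, Finset.sum_const, Finset.card_univ, nsmul_eq_mul,
          Finset.mul_sum]

theorem sum_abs_le_of_abs_le_sub_mul {β : Type*} [AddCommGroup G] [Fintype β]
    {ω φ : G → ℝ} (hω : IsBeurlingWeight ω) (hφ : ∀ k, 0 ≤ φ k) {B : ℝ}
    (hB : ∀ s : Finset G, ∑ k ∈ s, ω k * φ k ≤ B) (S : Finset (G × β)) {A : Matrix S S ℝ}
    (hA : ∀ i q, |A i q| ≤ φ (i.1.1 - q.1.1) * ω q.1.1) :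
    (∀ i, ∑ q, |A i q| ≤ Fintype.card β * B * ω i.1.1) ∧
      ∀ q, ∑ i, |A i q| ≤ Fintype.card β * B * ω q.1.1 := by
  classical
  refine ⟨fun i => ?_, fun q => ?_⟩
  · calc ∑ q, |A i q| ≤ ∑ q : S, φ (i.1.1 - q.1.1) * ω q.1.1 :=
          Finset.sum_le_sum fun q _ => hA i q
      _ = ∑ q ∈ S, φ (i.1.1 - q.1) * ω q.1 :=
          Finset.sum_coe_sort S fun q => φ (i.1.1 - q.1) * ω q.1
      _ ≤ Fintype.card β * ∑ k ∈ S.image Prod.fst, φ (i.1.1 - k) * ω k :=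
          sum_comp_fst_le (fun k => mul_nonneg (hφ _) (hω.nonneg k)) S
      _ ≤ Fintype.card β * B * ω i.1.1 := by
          rw [mul_assoc]
          gcongr
          exact hω.sum_sub_mul_row_le hφ hB _ i.1.1
  · calc ∑ i, |A i q| ≤ ∑ i : S, φ (i.1.1 - q.1.1) * ω q.1.1 :=
          Finset.sum_le_sum fun i _ => hA i q
      _ = ∑ i ∈ S, φ (i.1 - q.1.1) * ω q.1.1 :=
          Finset.sum_coe_sort S fun i => φ (i.1 - q.1.1) * ω q.1.1
      _ ≤ Fintype.card β * ∑ k ∈ S.image Prod.fst, φ (k - q.1.1) * ω q.1.1 :=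
          sum_comp_fst_le (f := fun k => φ (k - q.1.1) * ω q.1.1)
            (fun k => mul_nonneg (hφ _) (hω.nonneg _)) S
      _ ≤ Fintype.card β * B * ω q.1.1 := by
          rw [mul_assoc]
          gcongr
          exact hω.sum_sub_mul_col_le hφ hB _ q.1.1

end WeightedConvolution

section ConvolutionCalculus

variable {𝕜 R G τ : Type*} [NontriviallyNormedField 𝕜]

theorem coeff_mul_eq_sum [Semiring R] [AddGroup G] {T : Finset G} (f : R[G]) {g : R[G]}
    (hg : g.coeff.support ⊆ T) (k : G) :
    (f * g).coeff k = ∑ q ∈ T, f.coeff (k - q) * g.coeff q := by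
  rw [AddMonoidAlgebra.coeff_mul_apply_right, Finsupp.sum_of_support_subset _ hg _ (by simp)]
  simp only [sub_eq_add_neg]

theorem contDiff_coeff_aeval [NormedCommRing R] [NormedAlgebra 𝕜 R] [AddCommGroup G] {E : Type*}
    [NormedAddCommGroup E] [NormedSpace 𝕜 E] {n : WithTop ℕ∞} {T : Finset G}
    {A : τ → E → R[G]} (hsupport : ∀ v y, (A v y).coeff.support ⊆ T)
    (hA : ∀ v q, ContDiff 𝕜 n fun y => (A v y).coeff q) (P : MvPolynomial τ R) (k : G) :
    ContDiff 𝕜 n fun y => (MvPolynomial.aeval (A · y) P).coeff k := by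
  induction P using MvPolynomial.induction_on generalizing k with
  | C c => simpa only [MvPolynomial.aeval_C] using contDiff_const
  | add P Q hP hQ =>
    simpa only [map_add, AddMonoidAlgebra.coeff_add, Finsupp.add_apply] using (hP k).add (hQ k)
  | mul_X P v hP =>
    simp only [map_mul, MvPolynomial.aeval_X, coeff_mul_eq_sum _ (hsupport v _)]
    exact ContDiff.sum fun q _ => (hP (k - q)).mul (hA v q)

theorem hasDerivAt_coeff_mul [NormedRing R] [NormedAlgebra 𝕜 R] [AddGroup G] {T : Finset G}
    {f g : 𝕜 → R[G]} {f' g' : R[G]} {t : 𝕜} (hg_support : ∀ t, (g t).coeff.support ⊆ T)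
    (hg'_support : g'.coeff.support ⊆ T)
    (hf : ∀ q, HasDerivAt (fun t => (f t).coeff q) (f'.coeff q) t)
    (hg : ∀ q, HasDerivAt (fun t => (g t).coeff q) (g'.coeff q) t) (k : G) :
    HasDerivAt (fun t => (f t * g t).coeff k) ((f' * g t + f t * g').coeff k) t := by
  simp only [AddMonoidAlgebra.coeff_add, Finsupp.add_apply, coeff_mul_eq_sum _ (hg_support _),
    coeff_mul_eq_sum _ hg'_support, ← Finset.sum_add_distrib]
  exact HasDerivAt.fun_sum fun q _ => (hf (k - q)).fun_mul (hg q)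

theorem hasDerivAt_coeff_aeval [NormedCommRing R] [NormedAlgebra 𝕜 R] [AddCommGroup G]
    [Fintype τ] {T : Finset G} {A : τ → 𝕜 → R[G]} {A' : τ → R[G]} {t : 𝕜}
    (hsupport : ∀ v t, (A v t).coeff.support ⊆ T) (hsupport' : ∀ v, (A' v).coeff.support ⊆ T)
    (hA : ∀ v q, HasDerivAt (fun t => (A v t).coeff q) ((A' v).coeff q) t)
    (P : MvPolynomial τ R) (k : G) :
    HasDerivAt (fun t => (MvPolynomial.aeval (A · t) P).coeff k)
      ((∑ v, MvPolynomial.aeval (A · t) (MvPolynomial.pderiv v P) * A' v).coeff k) t := by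
  classical
  induction P using MvPolynomial.induction_on generalizing k with
  | C c => simpa using hasDerivAt_const t _
  | add P Q hP hQ =>
    simpa only [map_add, add_mul, Finset.sum_add_distrib, AddMonoidAlgebra.coeff_add,
      Finsupp.add_apply] using (hP k).fun_add (hQ k)
  | mul_X P w hP =>
    have hleibniz : ∑ v, MvPolynomial.aeval (A · t) (MvPolynomial.pderiv v (P * .X w)) * A' v =
        (∑ v, MvPolynomial.aeval (A · t) (MvPolynomial.pderiv v P) * A' v) * A w t +
          MvPolynomial.aeval (A · t) P * A' w := by
      simp only [Derivation.leibniz, MvPolynomial.pderiv_X, smul_eq_mul, map_add, map_mul,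
        MvPolynomial.aeval_X, add_mul, Finset.sum_add_distrib]
      rw [add_comm, Finset.sum_mul]
      congr 1
      · exact Finset.sum_congr rfl fun v _ => by ring
      · rw [Fintype.sum_eq_single w fun v hv => by simp [Pi.single_eq_of_ne hv.symm],
          Pi.single_eq_same, map_one, mul_one]
    simp only [hleibniz, map_mul, MvPolynomial.aeval_X]
    exact hasDerivAt_coeff_mul (hsupport w) (hsupport' w) hP (hA w) k

end ConvolutionCalculus

section FourierJets

theorem coeff_prod_eq_tsum {ι R G : Type*} [Fintype ι] [CommSemiring R] [TopologicalSpace R]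
    [AddCommMonoid G] (f : ι → R[G]) (k : G) :
    (∏ i, f i).coeff k = ∑' κ : {κ : ι → G // ∑ i, κ i = k}, ∏ i, (f i).coeff (κ.1 i) := by
  classical
  have hexpand : ∏ i, f i = ∑ κ ∈ Fintype.piFinset fun i => (f i).coeff.support,
      AddMonoidAlgebra.single (∑ i, κ i) (∏ i, (f i).coeff (κ i)) := by
    conv_lhs => enter [2, i]; rw [← AddMonoidAlgebra.sum_coeff_single (f i), Finsupp.sum]
    simp only [Finset.prod_univ_sum, AddMonoidAlgebra.prod_single]
  refine .trans ?_ (tsum_subtype {κ : ι → G | ∑ i, κ i = k}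
    fun κ => ∏ i, (f i).coeff (κ i)).symm
  rw [hexpand, AddMonoidAlgebra.coeff_sum, Finsupp.finsetSum_apply,
    tsum_eq_sum (s := Fintype.piFinset fun i => (f i).coeff.support)]
  · simp only [AddMonoidAlgebra.coeff_single, Finsupp.single_apply, Set.indicator_apply,
      Set.mem_ofPred_eq]
  · intro κ hκ
    obtain ⟨i, hi⟩ := not_forall.1 (mt Fintype.mem_piFinset.2 hκ)
    exact Set.indicator_apply_eq_zero.2 fun _ =>
      Finset.prod_eq_zero (Finset.mem_univ i) (Finsupp.notMem_support_iff.1 hi)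

theorem embed_of_mem {ι : Type} {H : SeqSpace} {S : Finset ι} (y : GalerkinSpace H S) {i : ι}
    (hi : i ∈ S) : embed H S y i = y ⟨i, hi⟩ :=
  dif_pos hi

theorem embed_of_notMem {ι : Type} {H : SeqSpace} {S : Finset ι} (y : GalerkinSpace H S) {i : ι}
    (hi : i ∉ S) : embed H S y i = 0 :=
  dif_neg hi

theorem embed_add {ι : Type} {H : SeqSpace} {S : Finset ι} (x y : GalerkinSpace H S) :
    embed H S (x + y) = embed H S x + embed H S y := by
  ext i
  by_cases hi : i ∈ S <;> simp [embed, hi]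

theorem embed_smul {ι : Type} {H : SeqSpace} {S : Finset ι} (c : ℝ) (x : GalerkinSpace H S) :
    embed H S (c • x) = c • embed H S x := by
  ext i
  by_cases hi : i ∈ S <;> simp [embed, hi]

theorem embed_single {ι : Type} [DecidableEq ι] {H : SeqSpace} {S : Finset ι} (q : S) :
    embed H S (PiLp.single H.exponent q 1) = Pi.single q.1 1 := by
  ext i
  by_cases hi : i ∈ S
  · simp [embed, hi, PiLp.single_apply, Pi.single_apply, Subtype.ext_iff]
  · simp [embed, hi, show i ≠ q from fun h => hi (h ▸ q.2)]

variable {d m r : ℕ} {H : SeqSpace} {S : Finset (Mode d m)}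

theorem coef_add (a b : Mode d m → ℝ) (k : Fin d → ℤ) (j : Fin m) :
    coef (a + b) k j = coef a k j + coef b k j :=
  rfl

theorem coef_smul (c : ℝ) (a : Mode d m → ℝ) (k : Fin d → ℤ) (j : Fin m) :
    coef (c • a) k j = c • coef a k j := by
  apply Complex.ext <;> simp [coef]

theorem coef_eq_zero {a : Mode d m → ℝ} {k : Fin d → ℤ} {j : Fin m}
    (ha : ∀ b, a (k, j, b) = 0) : coef a k j = 0 :=
  Complex.ext (ha false) (ha true)

theorem norm_coef_le_norm_coef {a b : Mode d m → ℝ} {k : Fin d → ℤ} {j : Fin m}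
    (hab : ∀ β, |a (k, j, β)| ≤ |b (k, j, β)|) : ‖coef a k j‖ ≤ ‖coef b k j‖ := by
  simp only [Complex.norm_def, Complex.normSq_apply, coef]
  exact Real.sqrt_le_sqrt
    (add_le_add (abs_le_iff_mul_self_le.1 (hab _)) (abs_le_iff_mul_self_le.1 (hab _)))

theorem norm_coef_embed_proj_le (z : Mode d m → ℝ) (k : Fin d → ℤ) (j : Fin m) :
    ‖coef (embed H S (proj H S z)) k j‖ ≤ ‖coef z k j‖ := by
  refine norm_coef_le_norm_coef fun b => ?_
  by_cases hi : (k, j, b) ∈ S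
  · rw [embed_of_mem _ hi]
    rfl
  · simp [embed_of_notMem _ hi]

theorem coef_embed_eq_zero (y : GalerkinSpace H S) {k : Fin d → ℤ} (hk : k ∉ S.image Prod.fst)
    (j : Fin m) : coef (embed H S y) k j = 0 :=
  coef_eq_zero fun _ => embed_of_notMem y fun h => hk (Finset.mem_image_of_mem Prod.fst h)

theorem norm_coef_single_le (q : Mode d m) (k : Fin d → ℤ) (j : Fin m) :
    ‖coef (Pi.single q 1) k j‖ ≤ 1 := by
  obtain ⟨k', j', b⟩ := q
  cases b <;> by_cases hk : k = k' <;> by_cases hj : j = j' <;>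
    simp [coef, hk, hj, Complex.norm_def, Complex.normSq_apply]

theorem jetCoef_add (a b : Mode d m → ℝ) (v : JetVar d m r) (k : Fin d → ℤ) :
    jetCoef (a + b) v k = jetCoef a v k + jetCoef b v k := by
  rw [jetCoef, coef_add, mul_add]
  rfl

theorem jetCoef_smul (c : ℝ) (a : Mode d m → ℝ) (v : JetVar d m r) (k : Fin d → ℤ) :
    jetCoef (c • a) v k = c • jetCoef a v k := by
  rw [jetCoef, coef_smul, mul_smul_comm]
  rfl

theorem jetCoef_embed_eq_zero (y : GalerkinSpace H S) (v : JetVar d m r) {k : Fin d → ℤ}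
    (hk : k ∉ S.image Prod.fst) : jetCoef (embed H S y) v k = 0 := by
  rw [jetCoef, coef_embed_eq_zero y hk, mul_zero]

theorem norm_jetCoef_le (a : Mode d m → ℝ) (v : JetVar d m r) {k : Fin d → ℤ} {w : ℝ}
    (hw : 1 ≤ w) (hk : ∀ i, |(k i : ℝ)| ≤ w) : ‖jetCoef a v k‖ ≤ w ^ r * ‖coef a k v.2‖ := by
  rw [jetCoef, norm_mul, norm_prod]
  gcongr
  calc ∏ i, ‖(Complex.I * (k i : ℂ)) ^ (v.1.1 i : ℕ)‖
      ≤ ∏ i, w ^ (v.1.1 i : ℕ) := by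
        gcongr with i
        rw [norm_pow, norm_mul, Complex.norm_I, one_mul, Complex.norm_intCast]
        gcongr
        exact hk i
    _ = w ^ (∑ i, (v.1.1 i : ℕ)) := Finset.prod_pow_eq_pow_sum _ _ _
    _ ≤ w ^ r := pow_le_pow_right₀ hw v.1.2

/-- The derivative `D^α u_j` of the trigonometric polynomial `u` with real coordinates `y`, as an
element of the convolution algebra of `ℤ^d`. -/
noncomputable def fourierJet (H : SeqSpace) (S : Finset (Mode d m)) (y : GalerkinSpace H S)
    (v : JetVar d m r) : ℂ[Fin d → ℤ] :=
  .ofCoeff <| Finsupp.onFinset (S.image Prod.fst) (jetCoef (embed H S y) v) fun _ =>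
    not_imp_comm.1 (jetCoef_embed_eq_zero y v)

theorem coeff_fourierJet (y : GalerkinSpace H S) (v : JetVar d m r) (k : Fin d → ℤ) :
    (fourierJet H S y v).coeff k = jetCoef (embed H S y) v k :=
  rfl

theorem support_fourierJet_subset (y : GalerkinSpace H S) (v : JetVar d m r) :
    (fourierJet H S y v).coeff.support ⊆ S.image Prod.fst :=
  fun _ hk => not_imp_comm.1 (jetCoef_embed_eq_zero y v) (Finsupp.mem_support_iff.1 hk)

theorem support_fourierJet_single_subset (q : S) (v : JetVar d m r) :
    (fourierJet H S (PiLp.single H.exponent q 1) v).coeff.support ⊆ {q.1.1} := by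
  intro k hk
  by_contra hkq
  refine Finsupp.mem_support_iff.1 hk ?_
  rw [coeff_fourierJet, embed_single, jetCoef, coef_eq_zero, mul_zero]
  exact fun b => Pi.single_eq_of_ne (fun h => hkq (by simp [← h])) _

theorem polyCoef_embed (P : MvPolynomial (JetVar d m r) ℂ) (y : GalerkinSpace H S)
    (k : Fin d → ℤ) :
    polyCoef P (embed H S y) k = (MvPolynomial.aeval (fourierJet H S y) P).coeff k := by
  have hmonomial (σ : JetVar d m r →₀ ℕ) :
      (∏ v, fourierJet H S y v ^ σ v).coeff k = monomialCoef σ (embed H S y) k := by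
    have hprod : ∏ v, fourierJet H S y v ^ σ v =
        ∏ i : Σ v, Fin (σ v), fourierJet H S y i.1 := by
      simp [Fintype.prod_sigma]
    rw [hprod, coeff_prod_eq_tsum]
    rfl
  simp only [polyCoef, ← hmonomial, MvPolynomial.aeval_def, MvPolynomial.eval₂_eq',
    AddMonoidAlgebra.coeff_sum, Finsupp.finsetSum_apply, ← Algebra.smul_def,
    AddMonoidAlgebra.coeff_smul, Finsupp.smul_apply, smul_eq_mul]

theorem contDiff_coeff_fourierJet (v : JetVar d m r) (k : Fin d → ℤ) {n : WithTop ℕ∞} :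
    ContDiff ℝ n fun y => (fourierJet H S y v).coeff k := by
  let jet : GalerkinSpace H S →ₗ[ℝ] ℂ :=
    { toFun y := jetCoef (embed H S y) v k
      map_add' x y := by rw [embed_add, jetCoef_add]
      map_smul' c y := by rw [embed_smul, jetCoef_smul, RingHom.id_apply] }
  exact jet.toContinuousLinearMap.contDiff

theorem contDiff_polyCoef_embed (P : MvPolynomial (JetVar d m r) ℂ) (k : Fin d → ℤ)
    {n : WithTop ℕ∞} : ContDiff ℝ n fun y : GalerkinSpace H S => polyCoef P (embed H S y) k := by
  simp only [polyCoef_embed]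
  exact contDiff_coeff_aeval (fun v y => support_fourierJet_subset y v)
    (fun v q => contDiff_coeff_fourierJet v q) P k

theorem fderiv_polyCoef_embed_apply (P : MvPolynomial (JetVar d m r) ℂ) (k : Fin d → ℤ)
    (y x : GalerkinSpace H S) :
    fderiv ℝ (fun y : GalerkinSpace H S => polyCoef P (embed H S y) k) y x =
      (∑ v, MvPolynomial.aeval (fourierJet H S y) (MvPolynomial.pderiv v P) *
        fourierJet H S x v).coeff k := by
  have hjet (v : JetVar d m r) (q : Fin d → ℤ) : HasDerivAt
      (fun t : ℝ => (fourierJet H S (y + t • x) v).coeff q) ((fourierJet H S x v).coeff q) 0 := by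
    simp only [coeff_fourierJet, embed_add, embed_smul, jetCoef_add, jetCoef_smul]
    simpa using ((hasDerivAt_id (0 : ℝ)).smul_const (jetCoef (embed H S x) v q)).const_add
      (jetCoef (embed H S y) v q)
  have hchain := hasDerivAt_coeff_aeval (fun v t => support_fourierJet_subset (y + t • x) v)
    (fun v => support_fourierJet_subset x v) hjet P k
  simp only [zero_smul, add_zero, ← polyCoef_embed] at hchain
  rw [← ((contDiff_polyCoef_embed P k (n := 1)).differentiable one_ne_zero y).lineDeriv_eq_fderiv]
  exact hchain.deriv

theorem norm_fderiv_polyCoef_embed_single_le (P : MvPolynomial (JetVar d m r) ℂ)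
    (k : Fin d → ℤ) (y : GalerkinSpace H S) (q : S) {w : ℝ} (hw : 1 ≤ w)
    (hq : ∀ i, |(q.1.1 i : ℝ)| ≤ w) :
    ‖fderiv ℝ (fun y : GalerkinSpace H S => polyCoef P (embed H S y) k) y
        (PiLp.single H.exponent q 1)‖ ≤
      (∑ v, ‖(MvPolynomial.aeval (fourierJet H S y) (MvPolynomial.pderiv v P)).coeff
        (k - q.1.1)‖) * w ^ r := by
  rw [fderiv_polyCoef_embed_apply, AddMonoidAlgebra.coeff_sum, Finsupp.finsetSum_apply,
    Finset.sum_mul]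
  refine norm_sum_le_of_le _ fun v _ => ?_
  rw [coeff_mul_eq_sum _ (support_fourierJet_single_subset q v), Finset.sum_singleton, norm_mul,
    coeff_fourierJet, embed_single]
  gcongr
  exact (norm_jetCoef_le _ v hw hq).trans
    (mul_le_of_le_one_right (by positivity) (norm_coef_single_le q.1 q.1.1 v.2))

end FourierJets

section LatticeSums

theorem summable_pi_int_norm_rpow {ι : Type*} [Fintype ι] {t : ℝ} (ht : t < -Fintype.card ι) :
    Summable fun k : ι → ℤ => ‖k‖ ^ t := by
  let b := (Pi.basisFun ℝ ι).restrictScalars ℤ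
  have hrank : Module.finrank ℤ (Submodule.span ℤ (Set.range (Pi.basisFun ℝ ι))) =
      Fintype.card ι := Module.finrank_eq_card_basis b
  have hnorm (k : ι → ℤ) : ‖b.equivFun.symm k‖ = ‖k‖ := by
    have hcoe : (b.equivFun.symm k : ι → ℝ) = fun i => (k i : ℝ) := by
      classical
      ext i
      simp [b, Module.Basis.equivFun_symm_apply, Pi.basisFun_apply, Pi.single_apply]
    rw [Submodule.coe_norm, hcoe]
    simp only [Pi.norm_def]
    congr! 3
  have hsum := ZLattice.summable_norm_rpow _ t (hrank.symm ▸ ht)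
  refine (b.equivFun.symm.toEquiv.summable_iff.2 hsum).congr fun k => ?_
  simpa using congrArg (· ^ t) (hnorm k)

variable {d : ℕ} {ν : AddGroupNorm (Fin d → ℤ)}

theorem norm_le_of_forall_abs_le (hν : ∀ (k : Fin d → ℤ) (i : Fin d), |(k i : ℝ)| ≤ ν k)
    (k : Fin d → ℤ) : ‖k‖ ≤ ν k :=
  (pi_norm_le_iff_of_nonneg (apply_nonneg ν k)).2 fun i => hν k i

theorem one_le_of_ne_zero (hν : ∀ (k : Fin d → ℤ) (i : Fin d), |(k i : ℝ)| ≤ ν k)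
    {k : Fin d → ℤ} (hk : k ≠ 0) : 1 ≤ ν k := by
  obtain ⟨i, hi⟩ := Function.ne_iff.1 hk
  refine le_trans ?_ (hν k i)
  exact_mod_cast Int.one_le_abs hi

theorem tendsto_cofinite_atTop (hν : ∀ (k : Fin d → ℤ) (i : Fin d), |(k i : ℝ)| ≤ ν k) :
    Tendsto ν cofinite atTop := by
  refine tendsto_atTop_mono (norm_le_of_forall_abs_le hν) ?_
  rw [← cocompact_eq_cofinite]
  exact tendsto_norm_cocompact_atTop

theorem summable_one_add_rpow (hν : ∀ (k : Fin d → ℤ) (i : Fin d), |(k i : ℝ)| ≤ ν k)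
    {t : ℝ} (ht : t < -d) : Summable fun k : Fin d → ℤ => (1 + ν k) ^ t := by
  refine (summable_pi_int_norm_rpow (by simpa using ht)).of_norm_bounded_eventually ?_
  filter_upwards [(Set.finite_singleton (0 : Fin d → ℤ)).compl_mem_cofinite] with k hk
  have hk_pos : 0 < ‖k‖ := norm_pos_iff.2 hk
  have hνk := norm_le_of_forall_abs_le hν k
  rw [Real.norm_of_nonneg (Real.rpow_nonneg (by linarith) t)]
  exact Real.rpow_le_rpow_of_nonpos hk_pos (by linarith) (by linarith [Nat.cast_nonneg (α := ℝ) d])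

theorem tendsto_div_one_add_pow_atTop
    (hν : ∀ (k : Fin d → ℤ) (i : Fin d), |(k i : ℝ)| ≤ ν k) {lam : (Fin d → ℤ) → ℝ}
    {p K L : ℝ} {r : ℕ} (hL : 0 < L) (hp : r < p) (hlam : ∀ k, K < ν k → L * ν k ^ p ≤ lam k) :
    Tendsto (fun k => lam k / (1 + ν k) ^ r) cofinite atTop := by
  have hlim : Tendsto (fun k => L / 2 ^ r * ν k ^ (p - r)) cofinite atTop :=
    ((tendsto_rpow_atTop (sub_pos.2 hp)).comp (tendsto_cofinite_atTop hν)).const_mul_atTop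
      (by positivity)
  refine tendsto_atTop_mono' _ ?_ hlim
  filter_upwards [(tendsto_cofinite_atTop hν).eventually_gt_atTop (max K 1)] with k hk
  obtain ⟨hKk, hk1⟩ := max_lt_iff.1 hk
  have hk0 : 0 < ν k := one_pos.trans hk1
  calc L / 2 ^ r * ν k ^ (p - r) = L * ν k ^ p / (2 * ν k) ^ r := by
        rw [Real.rpow_sub_natCast hk0.ne', mul_pow]
        ring
    _ ≤ lam k / (1 + ν k) ^ r := by
        have := hlam k hKk
        gcongr
        · exact (by positivity : 0 ≤ L * ν k ^ p).trans this
        · linarith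

end LatticeSums

section PolynomialDecay

variable {d m : ℕ} {ν : AddGroupNorm (Fin d → ℤ)}

theorem norm_coef_le_of_mem_polyDecaySet
    (hν : ∀ (k : Fin d → ℤ) (i : Fin d), |(k i : ℝ)| ≤ ν k) {C s : ℝ} (hs : 0 ≤ s)
    {z : Mode d m → ℝ} (hz : z ∈ polyDecaySet ν C s) (k : Fin d → ℤ) (j : Fin m) :
    ‖coef z k j‖ ≤ C * 2 ^ s * (1 + ν k) ^ (-s) := by
  have hC : 0 ≤ C := (norm_nonneg _).trans hz.2
  refine (PiLp.norm_apply_le (WithLp.toLp 2 (coef z k)) j).trans ?_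
  obtain rfl | hk := eq_or_ne k 0
  · refine hz.2.trans ?_
    simpa using le_mul_of_one_le_right hC (Real.one_le_rpow one_le_two hs)
  · have hk1 : 1 ≤ ν k := one_le_of_ne_zero hν hk
    calc ‖WithLp.toLp 2 (coef z k)‖ ≤ C / ν k ^ s := hz.1 k hk
      _ ≤ C / ((1 + ν k) / 2) ^ s := by
          gcongr
          linarith
      _ = C * 2 ^ s * (1 + ν k) ^ (-s) := by
          rw [Real.div_rpow (by positivity) zero_le_two, Real.rpow_neg (by positivity)]
          field_simp

theorem summable_one_add_pow_mul_rpow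
    (hν : ∀ (k : Fin d → ℤ) (i : Fin d), |(k i : ℝ)| ≤ ν k) {n : ℕ} {s : ℝ} (hs : n + d < s)
    (c : ℝ) : Summable fun k => (1 + ν k) ^ n * (c * (1 + ν k) ^ (-s)) := by
  refine ((summable_one_add_rpow hν (t := n - s) (by linarith)).mul_left c).congr fun k => ?_
  have hk : 0 < 1 + ν k := by linarith [apply_nonneg ν k]
  rw [sub_eq_add_neg, Real.rpow_add hk, Real.rpow_natCast]
  ring

theorem abs_apply_le_norm_coef (z : Mode d m → ℝ) (k : Fin d → ℤ) (j : Fin m) (b : Bool) :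
    |z (k, j, b)| ≤ ‖coef z k j‖ := by
  cases b
  · exact Complex.abs_re_le_norm (coef z k j)
  · exact Complex.abs_im_le_norm (coef z k j)

theorem summable_norm_of_norm_coef_le {ρ : (Fin d → ℤ) → ℝ} (hρ : Summable ρ)
    {z : Mode d m → ℝ} (hz : ∀ k j, ‖coef z k j‖ ≤ ρ k) : Summable fun i => ‖z i‖ := by
  have hsum : Summable fun i : Mode d m => |ρ i.1| * (1 : ℝ) :=
    hρ.abs.mul_of_nonneg (g := fun _ : Fin m × Bool => (1 : ℝ)) .of_finite
      (fun _ => abs_nonneg _) fun _ => zero_le_one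
  refine hsum.of_norm_bounded fun ⟨k, j, b⟩ => ?_
  rw [norm_norm, mul_one]
  exact (abs_apply_le_norm_coef z k j b).trans ((hz k j).trans (le_abs_self _))

theorem mem_carrier_of_summable_norm {ι : Type} {z : ι → ℝ} (hz : Summable fun i => ‖z i‖)
    (H : SeqSpace) : z ∈ H.carrier := by
  have hz1 : Memℓp z 1 := memℓp_gen (by simpa using hz)
  cases H with
  | c0 => exact hz.of_norm.tendsto_cofinite_zero
  | l1 => exact hz1
  | l2 => exact hz1.of_exponent_ge one_le_two

end PolynomialDecay

section GalerkinJacobian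

/-- The real part for `false` and the imaginary part for `true`, as in the last component of a
`Mode`. -/
noncomputable def partCLM : Bool → ℂ →L[ℝ] ℝ
  | false => Complex.reCLM
  | true => Complex.imCLM

theorem abs_partCLM_le (b : Bool) (z : ℂ) : |partCLM b z| ≤ ‖z‖ := by
  cases b
  · exact Complex.abs_re_le_norm z
  · exact Complex.abs_im_le_norm z

variable {d m r : ℕ} {H : SeqSpace} {S : Finset (Mode d m)} {ν : AddGroupNorm (Fin d → ℤ)}

theorem vectorField_apply (lam : (Fin d → ℤ) → ℝ) (N : Fin m → MvPolynomial (JetVar d m r) ℂ)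
    (a : Mode d m → ℝ) (i : Mode d m) :
    vectorField lam N a i = -lam i.1 * a i + partCLM i.2.2 (polyCoef (N i.2.1) a i.1) := by
  obtain ⟨k, j, b⟩ := i
  cases b <;> simp [vectorField, partCLM, coef]

theorem galerkin_vectorField_apply (lam : (Fin d → ℤ) → ℝ)
    (N : Fin m → MvPolynomial (JetVar d m r) ℂ) (y : GalerkinSpace H S) (i : S) :
    galerkin H S (vectorField lam N) y i =
      -lam i.1.1 * y i + partCLM i.1.2.2 (polyCoef (N i.1.2.1) (embed H S y) i.1.1) := by
  change vectorField lam N (embed H S y) i.1 = _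
  rw [vectorField_apply, embed_of_mem y i.2]

theorem contDiff_partCLM_polyCoef_embed (P : MvPolynomial (JetVar d m r) ℂ) (k : Fin d → ℤ)
    (b : Bool) {n : WithTop ℕ∞} :
    ContDiff ℝ n fun y : GalerkinSpace H S => partCLM b (polyCoef P (embed H S y) k) :=
  (partCLM b).contDiff.comp (contDiff_polyCoef_embed P k)

theorem contDiff_galerkin_vectorField (lam : (Fin d → ℤ) → ℝ)
    (N : Fin m → MvPolynomial (JetVar d m r) ℂ) {n : WithTop ℕ∞} :
    ContDiff ℝ n (galerkin H S (vectorField lam N)) := by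
  refine contDiff_piLp' _ fun i => ?_
  simp only [galerkin_vectorField_apply]
  exact (contDiff_const.mul (PiLp.proj (𝕜 := ℝ) H.exponent (fun _ : S => ℝ) i).contDiff).add
    (contDiff_partCLM_polyCoef_embed _ _ _)

/-- The matrix of partial derivatives, at `y`, of the Galerkin projection of the nonlinear part
of the vector field. -/
noncomputable def nonlinearJacobian (N : Fin m → MvPolynomial (JetVar d m r) ℂ)
    (y : GalerkinSpace H S) : Matrix S S ℝ :=
  .of fun i q => fderiv ℝ (fun y : GalerkinSpace H S =>
    partCLM i.1.2.2 (polyCoef (N i.1.2.1) (embed H S y) i.1.1)) y (PiLp.single H.exponent q 1)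

theorem continuousLinearMap_apply_eq_sum {ι : Type*} [Fintype ι] [DecidableEq ι] {p : ℝ≥0∞}
    (L : PiLp p (fun _ : ι => ℝ) →L[ℝ] ℝ) (x : PiLp p fun _ : ι => ℝ) :
    L x = ∑ i, L (PiLp.single p i 1) * x i := by
  have hx : x = ∑ i, x i • PiLp.single p i 1 := by
    ext i
    simp [WithLp.ofLp_sum, Pi.single_apply]
  conv_lhs => rw [hx, map_sum]
  simp only [map_smul, smul_eq_mul, mul_comm]

theorem fderiv_galerkin_vectorField_apply (lam : (Fin d → ℤ) → ℝ)
    (N : Fin m → MvPolynomial (JetVar d m r) ℂ) (y x : GalerkinSpace H S) (i : S) :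
    fderiv ℝ (galerkin H S (vectorField lam N)) y x i =
      -lam i.1.1 * x i + (nonlinearJacobian N y).mulVec x i := by
  have hgalerkin := (PiLp.hasFDerivAt_apply (𝕜 := ℝ) H.exponent _ i).comp y
    ((contDiff_galerkin_vectorField lam N (n := 1)).differentiable one_ne_zero y).hasFDerivAt
  have hcoord := ((PiLp.hasFDerivAt_apply (𝕜 := ℝ) H.exponent y i).const_mul (-lam i.1.1)).add
    ((contDiff_partCLM_polyCoef_embed (N i.1.2.1) i.1.1 i.1.2.2 (n := 1)).differentiable
      one_ne_zero y).hasFDerivAt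
  have happly := DFunLike.congr_fun
    (hgalerkin.unique (hcoord.congr_of_eventuallyEq
      (.of_forall fun y => galerkin_vectorField_apply lam N y i))) x
  exact happly.trans (congrArg (-lam i.1.1 * x i + ·) (continuousLinearMap_apply_eq_sum _ x))

theorem abs_nonlinearJacobian_le (hν : ∀ (k : Fin d → ℤ) (i : Fin d), |(k i : ℝ)| ≤ ν k)
    (N : Fin m → MvPolynomial (JetVar d m r) ℂ) (y : GalerkinSpace H S) (i q : S) :
    |nonlinearJacobian N y i q| ≤ (∑ j, ∑ v, ‖(MvPolynomial.aeval (fourierJet H S y)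
      (MvPolynomial.pderiv v (N j))).coeff (i.1.1 - q.1.1)‖) * (1 + ν q.1.1) ^ r := by
  have hpart : nonlinearJacobian N y i q = partCLM i.1.2.2 (fderiv ℝ (fun y : GalerkinSpace H S =>
      polyCoef (N i.1.2.1) (embed H S y) i.1.1) y (PiLp.single H.exponent q 1)) := by
    have hdiff := (contDiff_polyCoef_embed (H := H) (S := S) (N i.1.2.1) i.1.1
      (n := 1)).differentiable one_ne_zero y
    exact DFunLike.congr_fun ((partCLM i.1.2.2).hasFDerivAt.comp y hdiff.hasFDerivAt).fderiv _
  have hq := apply_nonneg ν q.1.1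
  rw [hpart]
  refine (abs_partCLM_le _ _).trans ((norm_fderiv_polyCoef_embed_single_le _ _ y q
    (w := 1 + ν q.1.1) (by linarith) fun j => (hν q.1.1 j).trans (by linarith)).trans ?_)
  gcongr
  exact Finset.single_le_sum (f := fun j => ∑ v, ‖(MvPolynomial.aeval (fourierJet H S y)
    (MvPolynomial.pderiv v (N j))).coeff (i.1.1 - q.1.1)‖)
    (fun j _ => Finset.sum_nonneg fun v _ => norm_nonneg _) (Finset.mem_univ i.1.2.1)

theorem exists_sum_abs_nonlinearJacobian_le
    (hν : ∀ (k : Fin d → ℤ) (i : Fin d), |(k i : ℝ)| ≤ ν k)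
    (N : Fin m → MvPolynomial (JetVar d m r) ℂ) (M : ℝ) :
    ∃ c : ℝ, ∀ (H : SeqSpace) (S : Finset (Mode d m)) (y : GalerkinSpace H S),
      (∀ v : JetVar d m r, weightedL1Norm (fun k => (1 + ν k) ^ r) (fourierJet H S y v) ≤ M) →
      (∀ i, ∑ q, |nonlinearJacobian N y i q| ≤ c * (1 + ν i.1.1) ^ r) ∧
        ∀ q, ∑ i, |nonlinearJacobian N y i q| ≤ c * (1 + ν q.1.1) ^ r := by
  have hω := isBeurlingWeight_one_add_seminorm_pow ν r
  choose B hB using fun j v => exists_weightedL1Norm_aeval_le hω M (MvPolynomial.pderiv v (N j))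
  refine ⟨Fintype.card (Fin m × Bool) * ∑ j, ∑ v, B j v, fun H S y hy => ?_⟩
  let β (k : Fin d → ℤ) : ℝ := ∑ j, ∑ v, ‖(MvPolynomial.aeval (fourierJet H S y)
    (MvPolynomial.pderiv v (N j))).coeff k‖
  have hβ (k) : 0 ≤ β k := Finset.sum_nonneg fun _ _ => Finset.sum_nonneg fun _ _ => norm_nonneg _
  have hβ_sum (s : Finset (Fin d → ℤ)) : ∑ k ∈ s, (1 + ν k) ^ r * β k ≤ ∑ j, ∑ v, B j v := by
    simp only [β, Finset.mul_sum]
    rw [Finset.sum_comm]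
    refine Finset.sum_le_sum fun j _ => ?_
    rw [Finset.sum_comm]
    exact Finset.sum_le_sum fun v _ =>
      (sum_le_weightedL1Norm hω.nonneg _ s).trans (hB j v _ hy)
  exact sum_abs_le_of_abs_le_sub_mul hω hβ hβ_sum S (abs_nonlinearJacobian_le hν N y)

end GalerkinJacobian

section UniformBound

variable {d m r : ℕ} {ν : AddGroupNorm (Fin d → ℤ)}

theorem weightedL1Norm_fourierJet_proj_le
    (hν : ∀ (k : Fin d → ℤ) (i : Fin d), |(k i : ℝ)| ≤ ν k) {ρ : (Fin d → ℤ) → ℝ}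
    (hρ : Summable fun k => (1 + ν k) ^ (2 * r) * ρ k) (H : SeqSpace) (S : Finset (Mode d m))
    {z : Mode d m → ℝ} (hz : ∀ k j, ‖coef z k j‖ ≤ ρ k) (v : JetVar d m r) :
    weightedL1Norm (fun k => (1 + ν k) ^ r) (fourierJet H S (proj H S z) v) ≤
      ∑' k, (1 + ν k) ^ (2 * r) * ρ k := by
  have hk_nonneg (k) : 0 ≤ 1 + ν k := by linarith [apply_nonneg ν k]
  have hρ_nonneg (k) : 0 ≤ ρ k := (norm_nonneg _).trans (hz k v.2)
  have hjet (k) : ‖(fourierJet H S (proj H S z) v).coeff k‖ ≤ (1 + ν k) ^ r * ρ k := by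
    refine (norm_jetCoef_le _ v (w := 1 + ν k) (by linarith [apply_nonneg ν k])
      fun i => (hν k i).trans (by linarith)).trans ?_
    exact mul_le_mul_of_nonneg_left ((norm_coef_embed_proj_le z k v.2).trans (hz k v.2))
      (pow_nonneg (hk_nonneg k) r)
  rw [weightedL1Norm_eq_sum _ (support_fourierJet_subset _ v)]
  calc ∑ k ∈ S.image Prod.fst, (1 + ν k) ^ r * ‖(fourierJet H S (proj H S z) v).coeff k‖
      ≤ ∑ k ∈ S.image Prod.fst, (1 + ν k) ^ (2 * r) * ρ k := by
        refine Finset.sum_le_sum fun k _ => ?_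
        rw [two_mul, pow_add, mul_assoc]
        exact mul_le_mul_of_nonneg_left (hjet k) (pow_nonneg (hk_nonneg k) r)
    _ ≤ ∑' k, (1 + ν k) ^ (2 * r) * ρ k :=
        hρ.sum_le_tsum _ fun k _ => mul_nonneg (pow_nonneg (hk_nonneg k) _) (hρ_nonneg k)

theorem exists_forall_mul_sub_le {α : Type*} {ω lam : α → ℝ} (hω : ∀ a, 0 < ω a)
    (hlam : Tendsto (fun a => lam a / ω a) cofinite atTop) (c : ℝ) :
    ∃ l, ∀ a, c * ω a - lam a ≤ l := by
  have hfin : {a | ¬ c ≤ lam a / ω a}.Finite := hlam.eventually_ge_atTop c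
  obtain ⟨l, hl⟩ := (hfin.image fun a => c * ω a - lam a).bddAbove
  refine ⟨max l 0, fun a => ?_⟩
  by_cases ha : c ≤ lam a / ω a
  · exact le_max_of_le_right (sub_nonpos.2 ((le_div_iff₀ (hω a)).1 ha))
  · exact le_max_of_le_left (hl (Set.mem_image_of_mem _ ha))

theorem exists_forall_isLogNorm_fderiv_galerkin_le
    (hν : ∀ (k : Fin d → ℤ) (i : Fin d), |(k i : ℝ)| ≤ ν k)
    (N : Fin m → MvPolynomial (JetVar d m r) ℂ) {lam : (Fin d → ℤ) → ℝ}
    (hlam : Tendsto (fun k => lam k / (1 + ν k) ^ r) cofinite atTop) {ρ : (Fin d → ℤ) → ℝ}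
    (hρ : Summable fun k => (1 + ν k) ^ (2 * r) * ρ k) :
    ∃ l : ℝ, ∀ (H : SeqSpace) (S : Finset (Mode d m)), S.Nonempty →
      ∀ z : Mode d m → ℝ, (∀ k j, ‖coef z k j‖ ≤ ρ k) →
        ∃ μ, IsLogNorm (fderiv ℝ (galerkin H S (vectorField lam N)) (proj H S z)) μ ∧ μ ≤ l := by
  obtain ⟨c, hc⟩ :=
    exists_sum_abs_nonlinearJacobian_le hν N (∑' k, (1 + ν k) ^ (2 * r) * ρ k)
  obtain ⟨l, hl⟩ := exists_forall_mul_sub_le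
    (fun k => pow_pos (by linarith [apply_nonneg ν k]) r) hlam c
  refine ⟨l, fun H S hS z hz => ?_⟩
  have := hS.to_subtype
  obtain ⟨hrow, hcol⟩ := hc H S (proj H S z) (weightedL1Norm_fourierJet_proj_le hν hρ H S hz)
  exact exists_isLogNorm_le_of_row_col _ (fderiv_galerkin_vectorField_apply lam N _)
    (fun i => by linarith [hrow i, hl i.1.1]) fun q => by linarith [hcol q, hl q.1.1]

end UniformBound

end TorusPDE

open TorusPDE in
theorem mainTheorem4_general {d m r : ℕ} {ν : AddGroupNorm (Fin d → ℤ)}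
    (hν : ∀ (k : Fin d → ℤ) (i : Fin d), |(k i : ℝ)| ≤ ν k)
    (N : Fin m → MvPolynomial (JetVar d m r) ℂ) {lam : (Fin d → ℤ) → ℝ}
    (hlam : Tendsto (fun k => lam k / (1 + ν k) ^ r) cofinite atTop) {ρ : (Fin d → ℤ) → ℝ}
    (hρ : Summable fun k => (1 + ν k) ^ (2 * r) * ρ k) {W : Set (Mode d m → ℝ)}
    (hW : ∀ z ∈ W, ∀ k j, ‖coef z k j‖ ≤ ρ k) (H : SeqSpace)
    (J : GalerkinFiltration (Mode d m)) : ConditionC2 H J (vectorField lam N) W := by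
  have hρ_summable : Summable ρ := by
    refine hρ.abs.of_norm_bounded fun k => ?_
    rw [abs_mul, abs_of_nonneg (by positivity : 0 ≤ (1 + ν k) ^ (2 * r))]
    exact le_mul_of_one_le_left (abs_nonneg _)
      ((isBeurlingWeight_one_add_seminorm_pow ν _).one_le k)
  obtain ⟨l, hl⟩ := exists_forall_isLogNorm_fderiv_galerkin_le hν N hlam hρ
  exact ⟨fun z hz => mem_carrier_of_summable_norm
      (summable_norm_of_norm_coef_le hρ_summable (hW z hz)) H,
    fun n => contDiff_galerkin_vectorField lam N,
    l, fun n z hz => hl H (J.sets n) (J.nonempty n) z (hW z hz)⟩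

theorem mainTheorem4 (d m r : ℕ)
    (ν : AddGroupNorm (Fin d → ℤ)) (hν : ∀ (k : Fin d → ℤ) (i : Fin d), |(k i : ℝ)| ≤ ν k)
    (N : Fin m → MvPolynomial (TorusPDE.JetVar d m r) ℂ)
    (lam : (Fin d → ℤ) → ℝ) (p K Llow Lup : ℝ) (hLlow : 0 < Llow) (hp : (r : ℝ) < p)
    (hlam : ∀ k : Fin d → ℤ, K < ν k → Llow * ν k ^ p ≤ lam k ∧ lam k ≤ Lup * ν k ^ p)
    (C s : ℝ) (hs : 2 * (r : ℝ) + d < s)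
    (H : TorusPDE.SeqSpace) (J : TorusPDE.GalerkinFiltration (TorusPDE.Mode d m)) :
    TorusPDE.ConditionC2 H J (TorusPDE.vectorField lam N) (TorusPDE.polyDecaySet ν C s) :=
  mainTheorem4_general hν N
    (TorusPDE.tendsto_div_one_add_pow_atTop hν hLlow hp fun k hk => (hlam k hk).1)
    (TorusPDE.summable_one_add_pow_mul_rpow hν (by exact_mod_cast hs) (C * 2 ^ s))
    (fun _ hz => TorusPDE.norm_coef_le_of_mem_polyDecaySet hν
      ((by positivity : 0 ≤ 2 * (r : ℝ) + d).trans hs.le) hz) H J
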